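/- Let $N\ge 2$ and let $A=(a_{ij})$ be an $N\times N$ matrix with entries in $\{0,1\}$ having no zero row and no zero column. Let $\mathcal O_A$ be the Cuntz–Krieger algebra, i.e. the unital C$^*$-algebra universally generated by partial isometries $s_1,\dots,s_N$ with $s_i^*s_i=\sum_{j}a_{ij}s_js_j^*$ for all $i$ and $\sum_i s_is_i^*=1$. For a finite word $K=(k_1,\dots,k_m)$ in $\{1,\dots,N\}$ put $s_K=s_{k_1}\cdots s_{k_m}$ (with $s_K=1$ for the empty word), and write $K\cup K'$ for concatenation and $K^a$ for the $a$-fold concatenation of $K$. Representations are unital $*$-representations on complex Hilbert spaces; inner products are linear in the second variable. *Cycle case.* Let $J=(j_1,\dots,j_k)$, $k\ge 1$, with $a_{j_{i-1}j_i}=1$ for $2\le i\le k$ and $a_{j_kj_1}=1$. A representation $(\mathcal H,\pi)$ of $\mathcal O_A$ is $P(J)$ with GP vector $\Omega$ if $\Omega$ is a cyclic unit vector, $\pi(s_J)\Omega=\Omega$, and $\{\pi(s_{j_l}\cdots s_{j_k})\Omega\}_{l=1}^k$ is an orthonormal family. $J$ is periodic if $J=J_0^m$ for some nonempty word $J_0$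 and some $m\ge 2$. *Chain case.* Let $J=(j_n)_{n\ge1}$ be an infinite sequence in $\{1,\dots,N\}$ with $a_{j_{n-1}j_n}=1$ for $n\ge2$. A representation $(\mathcal H,\pi)$ of $\mathcal O_A$ is $P(J)$ with GP vector $\Omega$ if $\Omega$ is a cyclic unit vector and $\{\pi(s_{j_n}^*\cdots s_{j_1}^*)\Omega\}_{n\ge1}$ is an orthonormal family. $J$ is eventually periodic if $J=J_0\cup J_1\cup J_1\cup J_1\cup\cdots$ for some nonempty words $J_0,J_1$. In either case let $(\mathcal H,\pi)$ be $P(J)$ with GP vector $\Omega$, and let $\omega=\langle\Omega\,|\,\pi(\cdot)\Omega\rangle$ be the corresponding state of $\mathcal O_A$. Then the following hold. (i) In the cycle case, for all finite words $J',J''$, $$\omega(s_{J'}s_{J''}^*)=\begin{cases}1&\text{if there is } 0\le p\le k-1 \text{ with } J',J''\in\{J^a\cup(j_1,\dots,j_p): a\ge0\},\\0&\text{otherwise.}\end{cases}$$ (ii) In the chain case, for all finite words $J',J''$, $$\omega(s_{J'}s_{J''}^*)=\begin{cases}1&\text{if } J'=J''=(j_1,\dots,j_m)\text{ for some } m\ge0,\\0&\text{otherwise.}\end{cases}$$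 (iii) If $\varphi$ is any state of $\mathcal O_A$ whose values on all $s_{J'}s_{J''}^*$ are given by the formula in (i) in the cycle case, respectively in (ii) in the chain case, then the GNS representation of $\varphi$ is $P(J)$ and is unitarily equivalent to $(\mathcal H,\pi)$. (iv) In the cycle case $\omega$ is pure if and only if $J$ is not periodic; in the chain case $\omega$ is pure if and only if $J$ is not eventually periodic. -/

import Mathlib

open scoped ComplexOrder ENNReal CStarAlgebra

universe u v

/-- `M_N({0,1})`: matrices with entries in `{0,1}` having no zero row and no zero column. -/
structure IsZeroOneMatrix {N : ℕ} (A : Matrix (Fin N) (Fin N) ℕ) : Prop where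
  entries : ∀ i j, A i j = 0 ∨ A i j = 1
  row_ne_zero : ∀ i, ∃ j, A i j ≠ 0
  col_ne_zero : ∀ j, ∃ i, A i j ≠ 0

section CuntzKrieger

/-- Partial isometries `t₁, …, t_N` in a unital star ring satisfying the Cuntz-Krieger relations
`tᵢ* tᵢ = ∑ⱼ aᵢⱼ tⱼ tⱼ*` and `∑ᵢ tᵢ tᵢ* = 1`. -/
structure IsCuntzKriegerFamily {N : ℕ} (A : Matrix (Fin N) (Fin N) ℕ) {B : Type*}
    [Ring B] [StarRing B] (t : Fin N → B) : Prop where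
  partial_isometry : ∀ i, t i * star (t i) * t i = t i
  star_mul_self : ∀ i, star (t i) * t i = ∑ j, A i j • (t j * star (t j))
  sum_mul_star : ∑ i, t i * star (t i) = 1

theorem IsCuntzKriegerFamily.norm_le_one {N : ℕ} {A : Matrix (Fin N) (Fin N) ℕ} {B : Type*}
    [CStarAlgebra B] {t : Fin N → B} (h : IsCuntzKriegerFamily A t) (i : Fin N) : ‖t i‖ ≤ 1 := by
  have h1 : IsStarProjection (t i * star (t i)) :=
    ⟨by rw [IsIdempotentElem, ← mul_assoc, h.partial_isometry i], IsSelfAdjoint.mul_star_self _⟩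
  have h2 := h1.norm_le
  rw [CStarRing.norm_self_mul_star] at h2
  nlinarith [norm_nonneg (t i)]

/-- A Cuntz-Krieger family for `A` in some nonzero unital C⋆-algebra of the universe `u`. -/
structure CuntzKriegerModel {N : ℕ} (A : Matrix (Fin N) (Fin N) ℕ) : Type (u + 1) where
  carrier : Type u
  [cstar : CStarAlgebra carrier]
  [nontrivial : Nontrivial carrier]
  gen : Fin N → carrier
  isFamily : IsCuntzKriegerFamily A gen

attribute [instance] CuntzKriegerModel.cstar CuntzKriegerModel.nontrivial

/-- The C⋆-algebra of all bounded families `(x_F)_F` with `x_F` in the C⋆-algebra of `F`, where `F`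
runs over all Cuntz-Krieger families for `A`, with the supremum norm. -/
abbrev CuntzKriegerProduct {N : ℕ} (A : Matrix (Fin N) (Fin N) ℕ) : Type (u + 1) :=
  lp (fun F : CuntzKriegerModel.{u} A => F.carrier) ∞

noncomputable instance CuntzKriegerProduct.instCStarAlgebra {N : ℕ}
    (A : Matrix (Fin N) (Fin N) ℕ) : CStarAlgebra (CuntzKriegerProduct.{u} A) where

/-- The element of the product whose component at each Cuntz-Krieger family is the `i`-th member
of that family. -/
noncomputable def CuntzKriegerProduct.gen {N : ℕ} (A : Matrix (Fin N) (Fin N) ℕ) (i : Fin N) :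
    CuntzKriegerProduct.{u} A :=
  ⟨fun F => F.gen i, memℓp_infty ⟨1, by rintro _ ⟨F, rfl⟩; exact F.isFamily.norm_le_one i⟩⟩

/-- The C⋆-subalgebra of the product generated by the universal Cuntz-Krieger family. -/
noncomputable def CuntzKriegerSubalgebra {N : ℕ} (A : Matrix (Fin N) (Fin N) ℕ) :
    StarSubalgebra ℂ (CuntzKriegerProduct.{u} A) :=
  (StarAlgebra.adjoin ℂ (Set.range (CuntzKriegerProduct.gen.{u} A))).topologicalClosure

instance CuntzKriegerSubalgebra.instIsClosed {N : ℕ} (A : Matrix (Fin N) (Fin N) ℕ) :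
    IsClosed (CuntzKriegerSubalgebra.{u} A : Set (CuntzKriegerProduct.{u} A)) :=
  StarSubalgebra.isClosed_topologicalClosure _

/-- The Cuntz-Krieger algebra `𝒪_A`: the C⋆-algebra universally generated by partial isometries
satisfying the Cuntz-Krieger relations for `A`. It is realized as the C⋆-algebra generated by the
direct sum of all Cuntz-Krieger families; its universal property is
`CuntzKriegerAlgebra.existsUnique_lift`. -/
def CuntzKriegerAlgebra {N : ℕ} (A : Matrix (Fin N) (Fin N) ℕ) : Type (u + 1) :=
  CuntzKriegerSubalgebra.{u} A

namespace CuntzKriegerAlgebra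

noncomputable instance instCStarAlgebra {N : ℕ} (A : Matrix (Fin N) (Fin N) ℕ) :
    CStarAlgebra (CuntzKriegerAlgebra.{u} A) :=
  inferInstanceAs (CStarAlgebra (CuntzKriegerSubalgebra.{u} A))

/-- The order of the C⋆-algebra `𝒪_A`, for which the positive elements are the `a* a`. -/
noncomputable instance instPartialOrder {N : ℕ} (A : Matrix (Fin N) (Fin N) ℕ) :
    PartialOrder (CuntzKriegerAlgebra.{u} A) :=
  CStarAlgebra.spectralOrder _

instance instStarOrderedRing {N : ℕ} (A : Matrix (Fin N) (Fin N) ℕ) :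
    StarOrderedRing (CuntzKriegerAlgebra.{u} A) :=
  CStarAlgebra.spectralOrderedRing _

/-- The canonical generators `s₁, …, s_N` of `𝒪_A`. -/
noncomputable def gen {N : ℕ} (A : Matrix (Fin N) (Fin N) ℕ) (i : Fin N) :
    CuntzKriegerAlgebra.{u} A :=
  (⟨CuntzKriegerProduct.gen A i, StarSubalgebra.le_topologicalClosure _
    (StarAlgebra.subset_adjoin ℂ _ ⟨i, rfl⟩)⟩ : CuntzKriegerSubalgebra.{u} A)

/-- The inclusion of `𝒪_A` into the product. -/
noncomputable def incl {N : ℕ} (A : Matrix (Fin N) (Fin N) ℕ) :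
    CuntzKriegerAlgebra.{u} A →⋆ₐ[ℂ] CuntzKriegerProduct.{u} A :=
  (CuntzKriegerSubalgebra.{u} A).subtype

theorem incl_injective {N : ℕ} (A : Matrix (Fin N) (Fin N) ℕ) :
    Function.Injective (incl.{u} A) := Subtype.val_injective

theorem incl_gen {N : ℕ} (A : Matrix (Fin N) (Fin N) ℕ) (i : Fin N) :
    incl.{u} A (gen A i) = CuntzKriegerProduct.gen A i := rfl

/-- The component of an element of `𝒪_A` at a given Cuntz-Krieger family. -/
noncomputable def component {N : ℕ} (A : Matrix (Fin N) (Fin N) ℕ)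
    (F : CuntzKriegerModel.{u} A) : CuntzKriegerAlgebra.{u} A →⋆ₐ[ℂ] F.carrier where
  toFun x := incl A x F
  map_one' := by rw [map_one]; rfl
  map_mul' x y := by rw [map_mul]; rfl
  map_zero' := by rw [map_zero]; rfl
  map_add' x y := by rw [map_add]; rfl
  commutes' r := by rw [AlgHomClass.commutes]; rfl
  map_star' x := by rw [map_star]; rfl

theorem component_gen {N : ℕ} (A : Matrix (Fin N) (Fin N) ℕ) (F : CuntzKriegerModel.{u} A)
    (i : Fin N) : component A F (gen A i) = F.gen i := rfl

theorem ext_component {N : ℕ} {A : Matrix (Fin N) (Fin N) ℕ} {x y : CuntzKriegerAlgebra.{u} A}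
    (h : ∀ F, component A F x = component A F y) : x = y :=
  incl_injective A (lp.ext (funext h))

/-- The canonical generators satisfy the Cuntz-Krieger relations. -/
theorem isCuntzKriegerFamily_gen {N : ℕ} (A : Matrix (Fin N) (Fin N) ℕ) :
    IsCuntzKriegerFamily A (gen.{u} A) where
  partial_isometry i := ext_component fun F => by
    simpa only [component_gen, map_mul, map_star] using F.isFamily.partial_isometry i
  star_mul_self i := ext_component fun F => by
    simpa only [component_gen, map_mul, map_star, map_sum, map_nsmul] using F.isFamily.star_mul_self i
  sum_mul_star := ext_component fun F => by
    simpa only [component_gen, map_mul, map_star, map_sum, map_one] using F.isFamily.sum_mul_star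

/-- Two unital star homomorphisms on `𝒪_A` agree if they agree on the generators. -/
theorem hom_ext {N : ℕ} {A : Matrix (Fin N) (Fin N) ℕ} {B : Type v} [CStarAlgebra B]
    {φ ψ : CuntzKriegerAlgebra.{u} A →⋆ₐ[ℂ] B} (h : ∀ i, φ (gen A i) = ψ (gen A i)) : φ = ψ := by
  have hφ : Continuous φ := map_continuous φ
  have hψ : Continuous ψ := map_continuous ψ
  have hc : CompleteSpace B := inferInstance
  refine StarAlgHom.ext_topologicalClosure (R := ℂ) (A := CuntzKriegerProduct.{u} A)
    (S := StarAlgebra.adjoin ℂ (Set.range (CuntzKriegerProduct.gen.{u} A))) hφ hψ ?_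
  refine StarAlgHom.ext_adjoin (R := ℂ) ?_
  rintro ⟨x, hx⟩ ⟨i, hi⟩
  subst hi
  exact h i

/-- The universal property of `𝒪_A`. -/
theorem existsUnique_lift {N : ℕ} (A : Matrix (Fin N) (Fin N) ℕ) {B : Type u}
    [CStarAlgebra B] (t : Fin N → B) (ht : IsCuntzKriegerFamily A t) :
    ∃! φ : CuntzKriegerAlgebra.{u} A →⋆ₐ[ℂ] B, ∀ i, φ (gen A i) = t i := by
  refine existsUnique_of_exists_of_unique ?_ fun φ ψ hφ hψ =>
    hom_ext fun i => (hφ i).trans (hψ i).symm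
  rcases subsingleton_or_nontrivial B with hB | hB
  · exact ⟨{ toFun := fun _ => 0
             map_one' := Subsingleton.elim _ _
             map_mul' := fun _ _ => Subsingleton.elim _ _
             map_zero' := rfl
             map_add' := fun _ _ => Subsingleton.elim _ _
             commutes' := fun _ => Subsingleton.elim _ _
             map_star' := fun _ => Subsingleton.elim _ _ }, fun _ => Subsingleton.elim _ _⟩
  · exact ⟨component A ⟨B, t, ht⟩, fun _ => rfl⟩

/-- `s_J = s_{j₁} ⋯ s_{j_k}` for a word `J = (j₁, …, j_k)`, with `s_J = 1` for the empty word. -/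
noncomputable def word {N : ℕ} (A : Matrix (Fin N) (Fin N) ℕ) (J : List (Fin N)) :
    CuntzKriegerAlgebra.{u} A :=
  (J.map (gen A)).prod

end CuntzKriegerAlgebra

end CuntzKrieger

section Words

/-- `J ∈ {1, …, N}*_{A,c}`: a nonempty word `(j₁, …, j_k)` with `a_{j_{i-1} j_i} = 1` for
`2 ≤ i ≤ k` and `a_{j_k j₁} = 1`. -/
def IsCyclicWord {N : ℕ} (A : Matrix (Fin N) (Fin N) ℕ) (J : List (Fin N)) : Prop :=
  J ≠ [] ∧ J.IsChain (fun a b => A a b = 1) ∧ ∀ a ∈ J.getLast?, ∀ b ∈ J.head?, A a b = 1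

/-- `J ∈ {1, …, N}^∞_A`. The sequence `(j_n)_{n ≥ 1}` is indexed from `0`: `J n` is `j_{n+1}`. -/
def IsInfiniteWord {N : ℕ} (A : Matrix (Fin N) (Fin N) ℕ) (J : ℕ → Fin N) : Prop :=
  ∀ n, A (J n) (J (n + 1)) = 1

/-- `J^m`, the concatenation of `m` copies of the word `J`. -/
def wordPow {α : Type*} (J : List α) (m : ℕ) : List α := (List.replicate m J).flatten

/-- A word is periodic if it is `J₀^m` for some nonempty word `J₀` and some `m ≥ 2`. -/
def IsPeriodicWord {α : Type*} (J : List α) : Prop :=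
  ∃ m : ℕ, 2 ≤ m ∧ ∃ J₀ : List α, J₀ ≠ [] ∧ J = wordPow J₀ m

/-- The initial segment `(j₁, …, j_m)` of a sequence. -/
def initialWord {α : Type*} (J : ℕ → α) (m : ℕ) : List α := (List.range m).map J

/-- A sequence `J` is eventually periodic if `J = J₀ ∪ J₁ ∪ J₁ ∪ ⋯` for nonempty words `J₀, J₁`,
that is, if all the words `J₀ ∪ J₁^m` are initial segments of `J`. -/
def IsEventuallyPeriodic {α : Type*} (J : ℕ → α) : Prop :=
  ∃ J₀ J₁ : List α, J₀ ≠ [] ∧ J₁ ≠ [] ∧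
    ∀ m : ℕ, initialWord J (J₀.length + m * J₁.length) = J₀ ++ wordPow J₁ m

open Classical in
/-- The value prescribed on `s_{J'} s_{J''}*` in the cycle case: `1` if for some `0 ≤ p ≤ k - 1`
both `J'` and `J''` belong to `{J^a ∪ (j₁, …, j_p) : a ≥ 0}`, and `0` otherwise. -/
noncomputable def cycleValue {N : ℕ} (J J' J'' : List (Fin N)) : ℂ :=
  if ∃ p < J.length, (∃ a : ℕ, J' = wordPow J a ++ J.take p) ∧
    (∃ b : ℕ, J'' = wordPow J b ++ J.take p) then 1 else 0

open Classical in
/-- The value prescribed on `s_{J'} s_{J''}*` in the chain case: `1` if `J' = J''` is an initial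
segment `(j₁, …, j_m)` of `J` with `m ≥ 0`, and `0` otherwise. -/
noncomputable def chainValue {N : ℕ} (J : ℕ → Fin N) (J' J'' : List (Fin N)) : ℂ :=
  if ∃ m : ℕ, J' = initialWord J m ∧ J'' = initialWord J m then 1 else 0

end Words

section Representations

/-- `Ω` is a cyclic vector of the representation `π`. -/
def IsCyclicVector {𝒪 H : Type*} [CStarAlgebra 𝒪] [NormedAddCommGroup H] [InnerProductSpace ℂ H]
    [CompleteSpace H] (π : 𝒪 →⋆ₐ[ℂ] (H →L[ℂ] H)) (Ω : H) : Prop :=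
  Dense (Set.range fun a : 𝒪 => π a Ω)

/-- Unitary equivalence of representations. -/
def UnitarilyEquivalent {𝒪 H K : Type*} [CStarAlgebra 𝒪]
    [NormedAddCommGroup H] [InnerProductSpace ℂ H] [CompleteSpace H]
    [NormedAddCommGroup K] [InnerProductSpace ℂ K] [CompleteSpace K]
    (π : 𝒪 →⋆ₐ[ℂ] (H →L[ℂ] H)) (ρ : 𝒪 →⋆ₐ[ℂ] (K →L[ℂ] K)) : Prop :=
  ∃ U : H ≃ₗᵢ[ℂ] K, ∀ (a : 𝒪) (v : H), U (π a v) = ρ a (U v)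

/-- `π` is `P(J)` with GP vector `Ω`, for a word `J = (j₁, …, j_k)`: `Ω` is a cyclic unit vector,
`π(s_J)Ω = Ω`, and the vectors `π(s_{j_l} ⋯ s_{j_k})Ω`, `l = 1, …, k`, are orthonormal. -/
structure IsCycleRep {N : ℕ} {A : Matrix (Fin N) (Fin N) ℕ} {H : Type v}
    [NormedAddCommGroup H] [InnerProductSpace ℂ H] [CompleteSpace H]
    (π : CuntzKriegerAlgebra.{u} A →⋆ₐ[ℂ] (H →L[ℂ] H)) (J : List (Fin N)) (Ω : H) : Prop where
  norm_eq_one : ‖Ω‖ = 1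
  cyclic : IsCyclicVector π Ω
  fixed : π (CuntzKriegerAlgebra.word A J) Ω = Ω
  orthonormal : Orthonormal ℂ fun l : Fin J.length =>
    π (CuntzKriegerAlgebra.word A (J.drop l)) Ω

/-- `π` is `P(J)` with GP vector `Ω`, for a sequence `J = (j_n)_{n ≥ 1}`: `Ω` is a cyclic unit
vector and the vectors `π(s_{j_n}* ⋯ s_{j_1}*)Ω`, `n ≥ 1`, are orthonormal. -/
structure IsChainRep {N : ℕ} {A : Matrix (Fin N) (Fin N) ℕ} {H : Type v}
    [NormedAddCommGroup H] [InnerProductSpace ℂ H] [CompleteSpace H]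
    (π : CuntzKriegerAlgebra.{u} A →⋆ₐ[ℂ] (H →L[ℂ] H)) (J : ℕ → Fin N) (Ω : H) : Prop where
  norm_eq_one : ‖Ω‖ = 1
  cyclic : IsCyclicVector π Ω
  orthonormal : Orthonormal ℂ fun n : ℕ =>
    π (star (CuntzKriegerAlgebra.word A (initialWord J (n + 1)))) Ω

end Representations

section States

/-- A state of a unital C⋆-algebra: a positive linear functional taking the value `1` at `1`. -/
def IsState {𝒪 : Type*} [CStarAlgebra 𝒪] [PartialOrder 𝒪] (φ : 𝒪 →ₚ[ℂ] ℂ) : Prop := φ 1 = 1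

/-- A state is pure if it is an extreme point of the convex set of all states. -/
def IsPureState {𝒪 : Type*} [CStarAlgebra 𝒪] [PartialOrder 𝒪] (φ : 𝒪 →ₚ[ℂ] ℂ) : Prop :=
  φ.toLinearMap ∈ Set.extremePoints ℝ
    {f : 𝒪 →ₗ[ℂ] ℂ | ∃ ψ : 𝒪 →ₚ[ℂ] ℂ, IsState ψ ∧ ψ.toLinearMap = f}

/-- The positive functional `a ↦ ⟨Ω | π(a)Ω⟩`; the inner product is linear in its second
argument. -/
noncomputable def vectorState {𝒪 H : Type*} [CStarAlgebra 𝒪] [PartialOrder 𝒪] [StarOrderedRing 𝒪]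
    [NormedAddCommGroup H] [InnerProductSpace ℂ H] [CompleteSpace H]
    (π : 𝒪 →⋆ₐ[ℂ] (H →L[ℂ] H)) (Ω : H) : 𝒪 →ₚ[ℂ] ℂ :=
  PositiveLinearMap.mk₀
    { toFun := fun a => inner ℂ Ω (π a Ω)
      map_add' := fun a b => by simp
      map_smul' := fun c a => by simp }
    (fun a ha => by
      obtain ⟨b, rfl⟩ := CStarAlgebra.nonneg_iff_eq_star_mul_self.mp ha
      have h : inner ℂ Ω (π (star b * b) Ω) = inner ℂ (π b Ω) (π b Ω) := by
        rw [map_mul, map_star, ContinuousLinearMap.star_eq_adjoint, mul_apply_eq_comp,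
          ContinuousLinearMap.adjoint_inner_right]
      change 0 ≤ inner ℂ Ω (π (star b * b) Ω)
      rw [h]
      rw [inner_self_eq_norm_sq_to_K]
      positivity)

end States

/-! The proof follows a sequence of vectors `v 0 = Ω, v 1, v 2, …` on which the letters of an
infinite word `x` act as shifts: `s_{x n}` sends `v (n+1)` to `v n`, and its adjoint sends `v n` to
`v (n+1)` (`IsOrbit`). In the cycle case `x` is `J ∪ J ∪ ⋯`. Distinct generators have orthogonal
ranges, so `s_K* Ω` is `v |K|` if `K` is an initial segment of `x`, and `0` otherwise. Hence
`ω(s_{J'} s_{J''}*)` is either an entry of the Gram matrix of `v` or `0`, which gives (i) and (ii).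
The elements `s_{J'} s_{J''}*` span a dense subspace, so `x` and the Gram matrix determine the state
(`IsOrbit.inner_eq_inner`). Then (iii) is the uniqueness of cyclic representations with a given
vector state.

For (iv), `⟨v m, v n⟩` vanishes as soon as the tails of `x` from `m` and from `n` differ. Without
periodicity this determines the Gram matrix, so `ω` is determined by having value `1` at certain
contractions. Both members of a convex decomposition inherit these values, because `1` is an extreme
point of the unit disc (`isPureState_of_unique`). With periodicity, some `wΩ` orthogonal to `Ω`
induces the same state, and superpositions of the two vectors decompose `ω`
(`not_isPureState_vectorState`). -/

/-! ### Vector states, the GNS representation and criteria for purity. -/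

section StatesAndRepresentations

variable {𝒪 : Type*} [CStarAlgebra 𝒪]
  {H K : Type*} [NormedAddCommGroup H] [InnerProductSpace ℂ H] [CompleteSpace H]
  [NormedAddCommGroup K] [InnerProductSpace ℂ K] [CompleteSpace K]

theorem inner_map_star (π : 𝒪 →⋆ₐ[ℂ] (H →L[ℂ] H)) (a : 𝒪) (x y : H) :
    inner ℂ x (π (star a) y) = inner ℂ (π a x) y := by
  rw [map_star, ContinuousLinearMap.star_eq_adjoint, ContinuousLinearMap.adjoint_inner_right]

theorem inner_map_star_left (π : 𝒪 →⋆ₐ[ℂ] (H →L[ℂ] H)) (a : 𝒪) (x y : H) :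
    inner ℂ (π (star a) x) y = inner ℂ x (π a y) := by
  rw [← inner_map_star, star_star]

theorem map_mul_vec (π : 𝒪 →⋆ₐ[ℂ] (H →L[ℂ] H)) (a b : 𝒪) (x : H) :
    π (a * b) x = π a (π b x) := by
  rw [map_mul, mul_apply_eq_comp]

theorem norm_map_apply_le (π : 𝒪 →⋆ₐ[ℂ] (H →L[ℂ] H)) {a : 𝒪} (ha : ‖a‖ ≤ 1) (x : H) :
    ‖π a x‖ ≤ ‖x‖ := by
  calc ‖π a x‖ ≤ ‖π a‖ * ‖x‖ := (π a).le_opNorm x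
    _ ≤ 1 * ‖x‖ := by gcongr; exact (NonUnitalStarAlgHom.norm_apply_le π a).trans ha
    _ = ‖x‖ := one_mul _

/-- A vector of the unit ball whose inner product with a unit vector `x` is `1` equals `x`. -/
theorem eq_of_inner_eq_one {H : Type*} [NormedAddCommGroup H] [InnerProductSpace ℂ H]
    {x y : H} (hx : ‖x‖ = 1) (hy : ‖y‖ ≤ 1) (h : inner ℂ x y = 1) :
    y = x := by
  have h1 : ‖x - y‖ ^ 2 ≤ 0 := by
    rw [@norm_sub_sq ℂ, h, hx]
    simp only [RCLike.one_re]
    nlinarith [norm_nonneg y]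
  have h2 : ‖x - y‖ = 0 := by nlinarith [norm_nonneg (x - y)]
  exact (sub_eq_zero.mp (norm_eq_zero.mp h2)).symm

theorem norm_eq_one_of_inner_self {H : Type*} [NormedAddCommGroup H] [InnerProductSpace ℂ H]
    {x : H} (h : inner ℂ x x = (1 : ℂ)) : ‖x‖ = 1 := by
  rw [inner_self_eq_norm_sq_to_K] at h
  have h' : ‖x‖ ^ 2 = 1 := Complex.ofReal_injective (by simpa using h)
  nlinarith [norm_nonneg x]

/-- Cyclic representations with the same vector state are unitarily equivalent. -/
theorem exists_unitary_of_inner_eq {ρ : 𝒪 →⋆ₐ[ℂ] (K →L[ℂ] K)} {π : 𝒪 →⋆ₐ[ℂ] (H →L[ℂ] H)}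
    {ξ : K} {Ω : H} (hξ : IsCyclicVector ρ ξ) (hΩ : IsCyclicVector π Ω)
    (h : ∀ a, inner ℂ ξ (ρ a ξ) = inner ℂ Ω (π a Ω)) :
    ∃ U : K ≃ₗᵢ[ℂ] H, (∀ a v, U (ρ a v) = π a (U v)) ∧ U ξ = Ω := by
  let e₁ : 𝒪 →ₗ[ℂ] K :=
    { toFun := fun a => ρ a ξ, map_add' := fun a b => by simp, map_smul' := fun c a => by simp }
  let e₂ : 𝒪 →ₗ[ℂ] H :=
    { toFun := fun a => π a Ω, map_add' := fun a b => by simp, map_smul' := fun c a => by simp }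
  -- Both squared norms are the value of the common state at `a* a`.
  have hn : ∀ a, ‖e₂ (LinearEquiv.refl ℂ 𝒪 a)‖ = ‖e₁ a‖ := fun a => by
    have h1 : inner ℂ (π a Ω) (π a Ω) = inner ℂ (ρ a ξ) (ρ a ξ) := by
      rw [← inner_map_star, ← inner_map_star, ← map_mul_vec, ← map_mul_vec, h]
    rw [inner_self_eq_norm_sq_to_K, inner_self_eq_norm_sq_to_K] at h1
    exact (sq_eq_sq₀ (norm_nonneg _) (norm_nonneg _)).mp (by exact_mod_cast h1)
  have hξ' : DenseRange e₁ := hξ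
  have hΩ' : DenseRange e₂ := hΩ
  let U := (LinearEquiv.refl ℂ 𝒪).extendOfIsometry e₁ e₂ hξ' hΩ' hn
  have hU : ∀ a, U (ρ a ξ) = π a Ω := fun a =>
    LinearEquiv.extendOfIsometry_eq (LinearEquiv.refl ℂ 𝒪) e₁ e₂ hξ' hΩ' hn a
  refine ⟨U, fun a v => ?_, by simpa using hU 1⟩
  refine hξ'.induction (P := fun v => U (ρ a v) = π a (U v)) ?_
    (isClosed_eq (by fun_prop) (by fun_prop)) v
  rintro _ ⟨b, rfl⟩
  change U (ρ a (ρ b ξ)) = π a (U (ρ b ξ))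
  rw [← map_mul_vec, hU, hU, map_mul_vec]

theorem IsCyclicVector.map_unitary {ρ : 𝒪 →⋆ₐ[ℂ] (K →L[ℂ] K)} {π : 𝒪 →⋆ₐ[ℂ] (H →L[ℂ] H)}
    {ξ : K} (hξ : IsCyclicVector ρ ξ) (U : K ≃ₗᵢ[ℂ] H) (hU : ∀ a v, U (ρ a v) = π a (U v)) :
    IsCyclicVector π (U ξ) := by
  have h1 : Dense (U '' Set.range fun a => ρ a ξ) :=
    U.surjective.denseRange.dense_image U.continuous hξ
  rwa [← Set.range_comp, show (U ∘ fun a => ρ a ξ) = fun a => π a (U ξ) from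
    funext fun a => hU a ξ] at h1

variable [PartialOrder 𝒪] [StarOrderedRing 𝒪]

/-- The canonical vector of the GNS representation. -/
noncomputable def gnsVector (φ : 𝒪 →ₚ[ℂ] ℂ) : φ.GNS := ((φ.toPreGNS 1 : φ.PreGNS) : φ.GNS)

theorem gnsStarAlgHom_gnsVector (φ : 𝒪 →ₚ[ℂ] ℂ) (a : 𝒪) :
    φ.gnsStarAlgHom a (gnsVector φ) = ((φ.toPreGNS a : φ.PreGNS) : φ.GNS) := by
  change φ.gnsNonUnitalStarAlgHom a (φ.toPreGNS 1 : φ.PreGNS) = _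
  rw [PositiveLinearMap.gnsNonUnitalStarAlgHom_apply_coe,
    PositiveLinearMap.leftMulMapPreGNS_apply]
  simp

theorem inner_gnsVector (φ : 𝒪 →ₚ[ℂ] ℂ) (a : 𝒪) :
    inner ℂ (gnsVector φ) (φ.gnsStarAlgHom a (gnsVector φ)) = φ a := by
  rw [gnsStarAlgHom_gnsVector, gnsVector, UniformSpace.Completion.inner_coe,
    PositiveLinearMap.preGNS_inner_def]
  simp

theorem isCyclicVector_gnsVector (φ : 𝒪 →ₚ[ℂ] ℂ) :
    IsCyclicVector (H := φ.GNS) φ.gnsStarAlgHom (gnsVector φ) := by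
  unfold IsCyclicVector
  simp_rw [gnsStarAlgHom_gnsVector]
  have h1 : DenseRange ((↑) : φ.PreGNS → φ.GNS) := UniformSpace.Completion.denseRange_coe
  exact h1.comp φ.toPreGNS.surjective.denseRange (UniformSpace.Completion.continuous_coe _)

theorem norm_gnsVector {φ : 𝒪 →ₚ[ℂ] ℂ} (hφ : IsState φ) : ‖gnsVector φ‖ = 1 := by
  refine norm_eq_one_of_inner_self ?_
  have h := inner_gnsVector φ 1
  rwa [map_one, hφ, one_apply_eq_self] at h

theorem vectorState_apply (π : 𝒪 →⋆ₐ[ℂ] (H →L[ℂ] H)) (Ω : H) (a : 𝒪) :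
    vectorState π Ω a = inner ℂ Ω (π a Ω) := rfl

theorem isState_vectorState (π : 𝒪 →⋆ₐ[ℂ] (H →L[ℂ] H)) {Ω : H} (hΩ : ‖Ω‖ = 1) :
    IsState (vectorState π Ω) := by
  rw [IsState, vectorState_apply, map_one, one_apply_eq_self,
    inner_self_eq_norm_sq_to_K, hΩ]
  simp

theorem IsState.norm_apply_le_one {φ : 𝒪 →ₚ[ℂ] ℂ} (hφ : IsState φ) {a : 𝒪} (ha : ‖a‖ ≤ 1) :
    ‖φ a‖ ≤ 1 := by
  rw [← inner_gnsVector]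
  have h := norm_map_apply_le φ.gnsStarAlgHom ha (gnsVector φ)
  rw [norm_gnsVector hφ] at h
  calc _ ≤ ‖gnsVector φ‖ * ‖φ.gnsStarAlgHom a (gnsVector φ)‖ := norm_inner_le_norm _ _
    _ ≤ 1 := by rw [norm_gnsVector hφ, one_mul]; exact h

/-- If a state has value `1` at a contraction `a`, its GNS vector is fixed by `a`. -/
theorem IsState.gns_fixed {φ : 𝒪 →ₚ[ℂ] ℂ} (hφ : IsState φ) {a : 𝒪} (ha : ‖a‖ ≤ 1)
    (h : φ a = 1) : φ.gnsStarAlgHom a (gnsVector φ) = gnsVector φ := by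
  refine eq_of_inner_eq_one (norm_gnsVector hφ) ?_ ((inner_gnsVector φ a).trans h)
  rw [← norm_gnsVector hφ]
  exact norm_map_apply_le _ ha _

/-- A state is pure if it is determined by the contractions at which it has value `1`. -/
theorem isPureState_of_unique {φ : 𝒪 →ₚ[ℂ] ℂ} (hφ : IsState φ)
    (h : ∀ ψ : 𝒪 →ₚ[ℂ] ℂ, IsState ψ → (∀ a, ‖a‖ ≤ 1 → φ a = 1 → ψ a = 1) → ∀ a, ψ a = φ a) :
    IsPureState φ := by
  refine ⟨⟨φ, hφ, rfl⟩, ?_⟩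
  rintro _ ⟨ψ₁, h₁, rfl⟩ _ ⟨ψ₂, h₂, rfl⟩ ⟨s, t, hs, ht, hst, hsum⟩
  refine LinearMap.ext fun a => h ψ₁ h₁ (fun a ha hφa => ?_) a
  have h3 : (s : ℂ) * ψ₁ a + t * ψ₂ a = 1 := by
    rw [← hφa]
    simpa using LinearMap.congr_fun hsum a
  have h4 : s * (ψ₁ a).re + t * (ψ₂ a).re = 1 := by
    have := congrArg Complex.re h3
    simpa using this
  have n1 := h₁.norm_apply_le_one ha
  have r1 := (Complex.re_le_norm (ψ₁ a)).trans n1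
  have r2 := (Complex.re_le_norm (ψ₂ a)).trans (h₂.norm_apply_le_one ha)
  -- A proper convex combination of two reals at most `1` is `1` only if both are. The bound on the
  -- norm then leaves no room for an imaginary part.
  have r3 : (ψ₁ a).re = 1 := by nlinarith
  have r4 : (ψ₁ a).im = 0 := by
    have := Complex.sq_norm (ψ₁ a)
    rw [Complex.normSq_apply, r3] at this
    nlinarith [norm_nonneg (ψ₁ a), mul_self_nonneg (ψ₁ a).im]
  exact Complex.ext r3 r4

/-- If an orthogonal translate `π(w)Ω` of `Ω` induces the same state as `Ω`, the state of `Ω` is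
not pure. -/
theorem not_isPureState_vectorState {π : 𝒪 →⋆ₐ[ℂ] (H →L[ℂ] H)} {Ω : H} (hΩ : ‖Ω‖ = 1) (w : 𝒪)
    (h0 : inner ℂ Ω (π w Ω) = 0)
    (hw : ∀ a, inner ℂ (π w Ω) (π a (π w Ω)) = inner ℂ Ω (π a Ω)) :
    ¬ IsPureState (vectorState π Ω) := by
  intro hp
  have hΩ1 : inner ℂ Ω Ω = (1 : ℂ) := by rw [inner_self_eq_norm_sq_to_K, hΩ]; simp
  have h0' : inner ℂ (π w Ω) Ω = 0 := by rw [← inner_conj_symm, h0, map_zero]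
  have hw1 : inner ℂ (π w Ω) (π w Ω) = (1 : ℂ) := by
    have := hw 1
    rwa [map_one, one_apply_eq_self, one_apply_eq_self, hΩ1] at this
  let r : ℂ := ((√2)⁻¹ : ℝ)
  have hr : (starRingEnd ℂ) r * r = 1 / 2 := by
    rw [Complex.conj_ofReal, ← Complex.ofReal_mul, ← mul_inv, Real.mul_self_sqrt (by norm_num)]
    norm_num
  -- For `|c| = 1` the states of `V c` and `V (-c)` average to that of `Ω`. If the latter is pure,
  -- the cross terms in `hV` must vanish.
  let V : ℂ → H := fun c => r • (Ω + c • π w Ω)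
  have hV : ∀ c a, inner ℂ (V c) (π a (V c)) =
      (1 / 2) * (inner ℂ Ω (π a Ω) + c * inner ℂ Ω (π a (π w Ω)) +
        (starRingEnd ℂ) c * inner ℂ (π w Ω) (π a Ω) +
        (starRingEnd ℂ) c * c * inner ℂ Ω (π a Ω)) := by
    intro c a
    simp only [V, map_add, map_smul, inner_smul_left, inner_smul_right, inner_add_left,
      inner_add_right, hw, ← hr]
    ring
  have key : ∀ c : ℂ, (starRingEnd ℂ) c * c = 1 → ∀ a,
      c * inner ℂ Ω (π a (π w Ω)) + (starRingEnd ℂ) c * inner ℂ (π w Ω) (π a Ω) = 0 := by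
    intro c hc a
    have hst : ∀ d : ℂ, (starRingEnd ℂ) d * d = 1 → IsState (vectorState π (V d)) := by
      intro d hd
      rw [IsState, vectorState_apply, hV, hd]
      rw [map_one, one_apply_eq_self, one_apply_eq_self, hΩ1, h0, h0']
      norm_num
    have := hp.2 ⟨_, hst c hc, rfl⟩ ⟨_, hst (-c) (by simpa using hc), rfl⟩
      ⟨1 / 2, 1 / 2, by norm_num, by norm_num, by norm_num, LinearMap.ext fun b => by
        change (1 / 2 : ℝ) • inner ℂ (V c) (π b (V c)) +
          (1 / 2 : ℝ) • inner ℂ (V (-c)) (π b (V (-c))) = inner ℂ Ω (π b Ω)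
        rw [hV, hV, map_neg, neg_mul_neg, hc, Complex.real_smul, Complex.real_smul]
        push_cast
        ring⟩
    have h2 : inner ℂ (V c) (π a (V c)) = inner ℂ Ω (π a Ω) := LinearMap.congr_fun this a
    rw [hV, hc] at h2
    linear_combination 2 * h2
  -- At `a = w*` the first cross term is `c`. With `z = ⟨wΩ, w*Ω⟩`, the choice `c = 1` gives `z =
  -- -1`, whereas `c = i` gives `z = 1`.
  have k1 := key 1 (by simp) (star w)
  have k2 := key Complex.I (by simp) (star w)
  rw [inner_map_star, hw1] at k1 k2
  simp only [map_one, Complex.conj_I] at k1 k2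
  have : (2 : ℂ) = 0 := by
    linear_combination k1 - Complex.I * k2 - (inner ℂ (π w Ω) (π (star w) Ω) - 1) * Complex.I_mul_I
  norm_num at this

end StatesAndRepresentations

/-! ### Relations between words and density of their span in `𝒪_A`. -/

namespace CuntzKriegerAlgebra

variable {N : ℕ} {A : Matrix (Fin N) (Fin N) ℕ}

/-- Compressing `∑ s_k s_k* = 1` by the projection `p = s_j s_j*` writes `p` as a sum of positive
elements. The term `k = j` is already `p`, so all the others vanish. -/
theorem star_gen_mul_gen_of_ne {i j : Fin N} (hij : i ≠ j) :
    star (gen.{u} A i) * gen A j = 0 := by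
  have hF := isCuntzKriegerFamily_gen.{u} A
  set p : CuntzKriegerAlgebra.{u} A := gen A j * star (gen A j) with hp
  have hpj : star (gen.{u} A j) * p = star (gen A j) := by
    have := congrArg star (hF.partial_isometry j)
    simpa only [star_mul, star_star, hp, mul_assoc] using this
  have hpstar : star p = p := by simp [hp]
  have hpp : p * p = p := by
    nth_rewrite 1 [hp]
    rw [mul_assoc, hpj]
  have hsum : ∑ k, star (star (gen.{u} A k) * p) * (star (gen A k) * p) = p := by
    have h1 : ∀ k, star (star (gen.{u} A k) * p) * (star (gen A k) * p)
        = p * (gen A k * star (gen A k)) * p := fun k => by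
      rw [star_mul, star_star, hpstar]
      simp only [mul_assoc]
    simp_rw [h1]
    rw [← Finset.sum_mul, ← Finset.mul_sum, hF.sum_mul_star, mul_one, hpp]
  rw [← Finset.add_sum_erase _ _ (Finset.mem_univ j), hpj, star_star, ← hp] at hsum
  have h0 := (Finset.sum_eq_zero_iff_of_nonneg fun k _ => star_mul_self_nonneg _).mp
    (add_eq_left.mp hsum) i (Finset.mem_erase.mpr ⟨hij, Finset.mem_univ _⟩)
  rw [CStarRing.star_mul_self_eq_zero_iff] at h0
  rw [← hF.partial_isometry j, ← hp, ← mul_assoc, h0, zero_mul]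

theorem star_gen_mul_gen_mul_gen (i j : Fin N) :
    star (gen.{u} A i) * gen A i * gen A j = A i j • gen A j := by
  have hF := isCuntzKriegerFamily_gen.{u} A
  rw [hF.star_mul_self, Finset.sum_mul, Finset.sum_eq_single j]
  · rw [smul_mul_assoc, hF.partial_isometry]
  · intro k _ hk
    rw [smul_mul_assoc, mul_assoc, star_gen_mul_gen_of_ne hk, mul_zero, smul_zero]
  · exact fun h => absurd (Finset.mem_univ j) h

theorem norm_gen_le (i : Fin N) : ‖gen.{u} A i‖ ≤ 1 := (isCuntzKriegerFamily_gen A).norm_le_one i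

@[simp] theorem word_nil : word.{u} A [] = 1 := rfl

theorem word_cons (i : Fin N) (J : List (Fin N)) : word.{u} A (i :: J) = gen A i * word A J := by
  simp [word]

theorem word_append (J K : List (Fin N)) : word.{u} A (J ++ K) = word A J * word A K := by
  simp [word]

theorem norm_word_le (J : List (Fin N)) : ‖word.{u} A J‖ ≤ 1 := by
  induction J with
  | nil => exact (IsStarProjection.one (R := CuntzKriegerAlgebra.{u} A)).norm_le
  | cons i J ih =>
    rw [word_cons]
    exact (norm_mul_le _ _).trans (mul_le_one₀ (norm_gen_le i) (norm_nonneg _) ih)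

/-- The linear span of the elements `s_{J'} s_{J''}*`. -/
noncomputable def wordSpan (A : Matrix (Fin N) (Fin N) ℕ) :
    Submodule ℂ (CuntzKriegerAlgebra.{u} A) :=
  Submodule.span ℂ (Set.range fun p : List (Fin N) × List (Fin N) => word A p.1 * star (word A p.2))

theorem word_mul_star_mem (J K : List (Fin N)) :
    word A J * star (word A K) ∈ wordSpan.{u} A := Submodule.subset_span ⟨(J, K), rfl⟩

theorem mul_mem_wordSpan {a x : CuntzKriegerAlgebra.{u} A}
    (h : ∀ J K, a * (word A J * star (word A K)) ∈ wordSpan.{u} A) (hx : x ∈ wordSpan A) :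
    a * x ∈ wordSpan A := by
  induction hx using Submodule.span_induction with
  | mem x hx => obtain ⟨p, rfl⟩ := hx; exact h p.1 p.2
  | zero => rw [mul_zero]; exact zero_mem _
  | add x y _ _ hx hy => rw [mul_add]; exact add_mem hx hy
  | smul c x _ hx => rw [mul_smul_comm]; exact Submodule.smul_mem _ c hx

theorem gen_mul_mem_wordSpan (i : Fin N) {x : CuntzKriegerAlgebra.{u} A} (hx : x ∈ wordSpan A) :
    gen A i * x ∈ wordSpan A := by
  refine mul_mem_wordSpan (fun J K => ?_) hx
  rw [← mul_assoc, ← word_cons]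
  exact word_mul_star_mem _ _

theorem star_gen_mul_mem_wordSpan (i : Fin N) {x : CuntzKriegerAlgebra.{u} A}
    (hx : x ∈ wordSpan A) : star (gen A i) * x ∈ wordSpan A := by
  refine mul_mem_wordSpan (fun J K => ?_) hx
  match J with
  | [] =>
    have : star (gen A i) * (word A [] * star (word A K)) =
        word.{u} A [] * star (word A (K ++ [i])) := by
      simp [word_append, word_cons]
    rw [this]
    exact word_mul_star_mem _ _
  | j :: J =>
    by_cases hij : i = j
    · subst hij
      match J with
      | [] =>
        have : star (gen A i) * (word A [i] * star (word A K)) =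
            -- No letter follows to absorb `s_i* s_i`, so it is expanded by the Cuntz-Krieger
            -- relation, which lengthens both words.
            ∑ j, A i j • (word.{u} A [j] * star (word A (K ++ [j]))) := by
          simp only [word_append, word_cons, word_nil, mul_one, star_mul, ← mul_assoc]
          rw [(isCuntzKriegerFamily_gen A).star_mul_self, Finset.sum_mul]
          simp only [smul_mul_assoc]
        rw [this]
        exact sum_mem fun j _ => nsmul_mem (word_mul_star_mem _ _) _
      | j :: J =>
        have : star (gen A i) * (word A (i :: j :: J) * star (word A K)) =
            A i j • (word.{u} A (j :: J) * star (word A K)) := by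
          simp only [word_cons, ← mul_assoc, star_gen_mul_gen_mul_gen, smul_mul_assoc]
        rw [this]
        exact nsmul_mem (word_mul_star_mem _ _) _
    · rw [word_cons, ← mul_assoc, ← mul_assoc, star_gen_mul_gen_of_ne hij, zero_mul, zero_mul]
      exact zero_mem _

theorem adjoin_subset_wordSpan {x : CuntzKriegerAlgebra.{u} A}
    (hx : x ∈ StarAlgebra.adjoin ℂ (Set.range (gen.{u} A))) : x ∈ wordSpan A := by
  have h1 : (1 : CuntzKriegerAlgebra.{u} A) ∈ wordSpan A := by
    simpa using word_mul_star_mem (A := A) [] []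
  -- The induction is on left multipliers of the span, since closure of the span under products is
  -- not known directly. Treating `x` and `x*` together makes the star case a swap.
  suffices h : ∀ y ∈ wordSpan.{u} A, x * y ∈ wordSpan A ∧ star x * y ∈ wordSpan A by
    simpa using (h 1 h1).1
  induction hx using StarAlgebra.adjoin_induction with
  | mem x hx =>
    obtain ⟨i, rfl⟩ := hx
    exact fun y hy => ⟨gen_mul_mem_wordSpan i hy, star_gen_mul_mem_wordSpan i hy⟩
  | algebraMap r =>
    intro y hy
    rw [← algebraMap_star_comm, ← Algebra.smul_def, ← Algebra.smul_def]
    exact ⟨Submodule.smul_mem _ _ hy, Submodule.smul_mem _ _ hy⟩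
  | add x y _ _ hx hy =>
    intro z hz
    rw [star_add, add_mul, add_mul]
    exact ⟨add_mem (hx z hz).1 (hy z hz).1, add_mem (hx z hz).2 (hy z hz).2⟩
  | mul x y _ _ hx hy =>
    intro z hz
    rw [star_mul, mul_assoc, mul_assoc]
    exact ⟨(hx _ (hy z hz).1).1, (hy _ (hx z hz).2).2⟩
  | star x _ hx =>
    intro z hz
    rw [star_star]
    exact (hx z hz).symm

theorem dense_adjoin :
    Dense (StarAlgebra.adjoin ℂ (Set.range (gen.{u} A)) : Set (CuntzKriegerAlgebra.{u} A)) := by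
  intro x
  have hind : Topology.IsInducing (incl.{u} A) := Topology.IsInducing.subtypeVal
  rw [hind.closure_eq_preimage_closure_image, Set.mem_preimage]
  have himg : incl.{u} A '' (StarAlgebra.adjoin ℂ (Set.range (gen.{u} A)) : Set _) =
      (StarAlgebra.adjoin ℂ (Set.range (CuntzKriegerProduct.gen.{u} A)) : Set _) := by
    rw [← StarSubalgebra.coe_map, StarAlgHom.map_adjoin, ← Set.range_comp]
    rfl
  rw [himg]
  exact x.2

theorem dense_wordSpan : Dense (wordSpan.{u} A : Set (CuntzKriegerAlgebra.{u} A)) :=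
  dense_adjoin.mono fun _ => adjoin_subset_wordSpan

/-- Positive functionals on `𝒪_A` are determined by their values on the `s_{J'} s_{J''}*`. -/
theorem positive_ext {φ ψ : CuntzKriegerAlgebra.{u} A →ₚ[ℂ] ℂ}
    (h : ∀ J K, φ (word A J * star (word A K)) = ψ (word A J * star (word A K)))
    (a : CuntzKriegerAlgebra.{u} A) : φ a = ψ a := by
  have hφ : Continuous φ := map_continuous φ
  have hψ : Continuous ψ := map_continuous ψ
  refine dense_wordSpan.induction (P := fun a => φ a = ψ a) (fun x hx => ?_)
    (isClosed_eq hφ hψ) a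
  induction hx using Submodule.span_induction with
  | mem x hx => obtain ⟨p, rfl⟩ := hx; exact h p.1 p.2
  | zero => rw [map_zero, map_zero]
  | add x y _ _ hx hy => rw [map_add, map_add, hx, hy]
  | smul c x _ hx => rw [map_smul, map_smul, hx]

end CuntzKriegerAlgebra

/-! ### Periodicity of words and sequences. -/

section Sequences

variable {α : Type*}

@[simp] theorem length_initialWord (x : ℕ → α) (m : ℕ) : (initialWord x m).length = m := by
  simp [initialWord]

@[simp] theorem initialWord_zero (x : ℕ → α) : initialWord x 0 = [] := rfl

theorem getElem_initialWord (x : ℕ → α) (m i : ℕ) (h : i < (initialWord x m).length) :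
    (initialWord x m)[i] = x i := by
  simp [initialWord]

theorem initialWord_add (x : ℕ → α) (m n : ℕ) :
    initialWord x (m + n) = initialWord x m ++ initialWord (fun i => x (m + i)) n := by
  simp [initialWord, List.range_add, Function.comp_def]

theorem initialWord_succ (x : ℕ → α) (m : ℕ) :
    initialWord x (m + 1) = initialWord x m ++ [x m] := by
  simp [initialWord, List.range_succ]

theorem initialWord_succ' (x : ℕ → α) (m : ℕ) :
    initialWord x (m + 1) = x 0 :: initialWord (fun i => x (1 + i)) m := by
  rw [add_comm, initialWord_add]
  rfl

theorem eq_of_initialWord_eq {x y : ℕ → α} {m : ℕ} (h : initialWord x m = initialWord y m)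
    {i : ℕ} (hi : i < m) : x i = y i := by
  rw [← getElem_initialWord x m i (by simpa), ← getElem_initialWord y m i (by simpa)]
  simp only [h]

@[simp] theorem length_wordPow (J : List α) (m : ℕ) : (wordPow J m).length = m * J.length := by
  simp [wordPow]

theorem wordPow_succ (J : List α) (m : ℕ) : wordPow J (m + 1) = J ++ wordPow J m := by
  simp [wordPow, List.replicate_succ]

/-- The initial segments of a sequence with period `d` are powers of the one of length `d`. -/
theorem initialWord_mul_of_periodic {x : ℕ → α} {d : ℕ} (h : ∀ i, x (d + i) = x i) (m : ℕ) :
    initialWord x (m * d) = wordPow (initialWord x d) m := by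
  induction m with
  | zero => simp [wordPow]
  | succ m ih => rw [wordPow_succ, ← ih, add_mul, one_mul, add_comm, initialWord_add, funext h]

/-- The periodic sequence `J ∪ J ∪ ⋯`. -/
def cyclicSeq (J : List α) (hJ : J ≠ []) : ℕ → α :=
  fun n => J[n % J.length]'(Nat.mod_lt _ (List.length_pos_iff.mpr hJ))

theorem cyclicSeq_add (J : List α) (hJ : J ≠ []) (i : ℕ) :
    cyclicSeq J hJ (J.length + i) = cyclicSeq J hJ i := by
  simp [cyclicSeq]

theorem initialWord_cyclicSeq (J : List α) (hJ : J ≠ []) {p : ℕ} (hp : p ≤ J.length) :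
    initialWord (cyclicSeq J hJ) p = J.take p := by
  refine List.ext_getElem (by simpa) fun i h₁ h₂ => ?_
  rw [length_initialWord] at h₁
  simp [getElem_initialWord, cyclicSeq, Nat.mod_eq_of_lt (h₁.trans_le hp)]

theorem initialWord_cyclicSeq_length (J : List α) (hJ : J ≠ []) :
    initialWord (cyclicSeq J hJ) J.length = J := by
  rw [initialWord_cyclicSeq J hJ le_rfl, List.take_length]

theorem initialWord_cyclicSeq_mul (J : List α) (hJ : J ≠ []) (a : ℕ) :
    initialWord (cyclicSeq J hJ) (a * J.length) = wordPow J a := by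
  rw [initialWord_mul_of_periodic (cyclicSeq_add J hJ), initialWord_cyclicSeq_length]

theorem initialWord_cyclicSeq_mul_add (J : List α) (hJ : J ≠ []) (a : ℕ) {p : ℕ}
    (hp : p ≤ J.length) :
    initialWord (cyclicSeq J hJ) (a * J.length + p) = wordPow J a ++ J.take p := by
  have h : (fun i => cyclicSeq J hJ (a * J.length + i)) = cyclicSeq J hJ := by
    funext i
    simp [cyclicSeq]
  rw [initialWord_add, h, initialWord_cyclicSeq_mul, initialWord_cyclicSeq J hJ hp]

theorem cyclicSeq_wordPow (J : List α) (hJ : J ≠ []) (m : ℕ) (hm : wordPow J m ≠ []) :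
    cyclicSeq (wordPow J m) hm = cyclicSeq J hJ := by
  funext n
  have h := initialWord_cyclicSeq_mul J hJ m
  have hl : n % (wordPow J m).length < (wordPow J m).length :=
    Nat.mod_lt _ (List.length_pos_iff.mpr hm)
  have h1 : (wordPow J m)[n % (wordPow J m).length] = cyclicSeq J hJ (n % (wordPow J m).length) := by
    simp only [← h]
    exact getElem_initialWord _ _ _ _
  rw [cyclicSeq, h1]
  simp [cyclicSeq]

theorem isPeriodicWord_of_period {J : List α} (hJ : J ≠ []) {d : ℕ}
    (hd : ∀ i, cyclicSeq J hJ (d + i) = cyclicSeq J hJ i) (hdvd : d ∣ J.length)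
    (hlt : d < J.length) : IsPeriodicWord J := by
  obtain ⟨m, hm⟩ := hdvd
  have hpos : 0 < J.length := List.length_pos_iff.mpr hJ
  have hd0 : 0 < d := Nat.pos_of_ne_zero fun h => by simp [h] at hm; exact hJ hm
  refine ⟨m, ?_, initialWord (cyclicSeq J hJ) d, ?_, ?_⟩
  · by_contra h
    interval_cases m <;> omega
  · rw [← List.length_pos_iff]
    simpa
  · rw [← initialWord_mul_of_periodic hd, mul_comm, ← hm, initialWord_cyclicSeq_length]

theorem iterate_shift (x : ℕ → α) (m : ℕ) :
    (fun (y : ℕ → α) i => y (1 + i))^[m] x = fun i => x (m + i) := by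
  induction m with
  | zero => simp
  | succ m ih =>
    rw [Function.iterate_succ_apply', ih]
    funext i
    rw [add_assoc]

theorem isPeriodicPt_shift {x : ℕ → α} {m : ℕ} :
    Function.IsPeriodicPt (fun (y : ℕ → α) i => y (1 + i)) m x ↔ ∀ i, x (m + i) = x i := by
  rw [Function.IsPeriodicPt, Function.IsFixedPt, iterate_shift, funext_iff]

/-- If a word is not periodic, the shifts of its periodic extension are distinct up to its
length. -/
theorem mod_eq_of_cyclicSeq_shift_eq {J : List α} (hJ : J ≠ []) (hper : ¬ IsPeriodicWord J)
    {m n : ℕ} (h : ∀ i, cyclicSeq J hJ (m + i) = cyclicSeq J hJ (n + i)) :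
    m % J.length = n % J.length := by
  wlog hmn : m ≤ n generalizing m n
  · exact (this (fun i => (h i).symm) (Nat.le_of_not_le hmn)).symm
  obtain ⟨d, rfl⟩ := Nat.exists_eq_add_of_le hmn
  have hpos : 0 < J.length := List.length_pos_iff.mpr hJ
  have hk := isPeriodicPt_shift.mpr (cyclicSeq_add J hJ)
  -- Equality of tails gives the period `d` only from index `m` on. Moving forward by `m` full
  -- copies of `J` passes that index without changing the sequence.
  have hd : ∀ i, cyclicSeq J hJ (d + i) = cyclicSeq J hJ i := fun i => by
    have h1 := isPeriodicPt_shift.mp (hk.const_mul m)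
    have hle : m ≤ m * J.length := Nat.le_mul_of_pos_right m hpos
    rw [← h1 (d + i), ← h1 i, show m * J.length + (d + i) = m + d + (m * J.length - m + i) by omega,
      ← h, show m + (m * J.length - m + i) = m * J.length + i by omega]
  -- The gcd of two periods is a period. It divides the length of `J`, so unless it equals that
  -- length `J` is a proper power.
  have hg := isPeriodicPt_shift.mp ((isPeriodicPt_shift.mpr hd).gcd hk)
  by_contra hne
  refine hper (isPeriodicWord_of_period hJ hg (Nat.gcd_dvd_right _ _)
    (lt_of_le_of_ne (Nat.gcd_le_right _ hpos) fun hgk => hne ?_))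
  obtain ⟨c, hc⟩ := hgk ▸ Nat.gcd_dvd_left d J.length
  rw [hc, Nat.add_mul_mod_self_left]

theorem isEventuallyPeriodic_iff {x : ℕ → α} :
    IsEventuallyPeriodic x ↔ ∃ k d, 0 < d ∧ ∀ i, x (k + d + i) = x (k + i) := by
  constructor
  · rintro ⟨J₀, J₁, -, h₁, h⟩
    have hc : ∀ i, x (J₀.length + i) = cyclicSeq J₁ h₁ i := fun i => by
      -- As `J₁` is nonempty, `i + 1` copies of it reach past index `i`.
      have hm := h (i + 1)
      rw [initialWord_add, ← initialWord_cyclicSeq_mul J₁ h₁] at hm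
      refine eq_of_initialWord_eq (List.append_inj_right hm (by simp)) ?_
      exact (Nat.lt_succ_self i).trans_le
        (Nat.le_mul_of_pos_right _ (List.length_pos_iff.mpr h₁))
    refine ⟨J₀.length, J₁.length, List.length_pos_iff.mpr h₁, fun i => ?_⟩
    rw [add_assoc, hc, hc, cyclicSeq_add]
  · rintro ⟨k, d, hd, h⟩
    -- The cut is at `k + 1` so that `J₀` is nonempty even if `k = 0`.
    refine ⟨initialWord x (k + 1), initialWord (fun i => x (k + 1 + i)) d, ?_, ?_, fun m => ?_⟩
    · rw [← List.length_pos_iff]; simp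
    · rw [← List.length_pos_iff]; simpa
    · rw [length_initialWord, length_initialWord, initialWord_add, initialWord_mul_of_periodic]
      intro i
      rw [show k + 1 + (d + i) = k + d + (1 + i) by ring, h, add_assoc]

theorem eq_of_shift_eq {x : ℕ → α} (hx : ¬ IsEventuallyPeriodic x) {m n : ℕ}
    (h : ∀ i, x (m + i) = x (n + i)) : m = n := by
  wlog hmn : m ≤ n generalizing m n
  · exact (this (fun i => (h i).symm) (Nat.le_of_not_le hmn)).symm
  by_contra hne
  refine hx (isEventuallyPeriodic_iff.mpr ⟨m, n - m, by omega, fun i => ?_⟩)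
  rw [Nat.add_sub_cancel' hmn, h]

end Sequences

/-! ### The prescribed values in terms of initial segments and lengths, as
`IsOrbit.inner_word_mul_star` produces them. -/

section Values

variable {N : ℕ}

open Classical in
theorem cycleValue_eq (J : List (Fin N)) (hJ : J ≠ []) (J' J'' : List (Fin N)) :
    cycleValue J J' J'' =
      if J' = initialWord (cyclicSeq J hJ) J'.length ∧ J'' = initialWord (cyclicSeq J hJ) J''.length
      then if J'.length % J.length = J''.length % J.length then 1 else 0 else 0 := by
  rw [cycleValue, ← ite_and]
  refine if_congr ?_ rfl rfl
  constructor
  · rintro ⟨p, hp, ⟨a, ha⟩, ⟨b, hb⟩⟩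
    rw [← initialWord_cyclicSeq_mul_add J hJ _ hp.le] at ha hb
    subst ha hb
    simp
  · rintro ⟨⟨h₁, h₂⟩, h₃⟩
    have hlt : J'.length % J.length < J.length := Nat.mod_lt _ (List.length_pos_iff.mpr hJ)
    refine ⟨J'.length % J.length, hlt, ⟨J'.length / J.length, ?_⟩, ⟨J''.length / J.length, ?_⟩⟩
    · rw [← initialWord_cyclicSeq_mul_add J hJ _ hlt.le, Nat.div_add_mod']
      exact h₁
    · rw [← initialWord_cyclicSeq_mul_add J hJ _ hlt.le, h₃, Nat.div_add_mod']
      exact h₂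

open Classical in
theorem chainValue_eq (x : ℕ → Fin N) (J' J'' : List (Fin N)) :
    chainValue x J' J'' =
      if J' = initialWord x J'.length ∧ J'' = initialWord x J''.length
      then if J'.length = J''.length then 1 else 0 else 0 := by
  rw [chainValue, ← ite_and]
  refine if_congr ?_ rfl rfl
  constructor
  · rintro ⟨m, rfl, rfl⟩
    simp
  · rintro ⟨⟨h₁, h₂⟩, h₃⟩
    exact ⟨_, h₁, h₃ ▸ h₂⟩

end Values

/-! ### Orbits of vectors along an infinite word. -/

section Orbits

open CuntzKriegerAlgebra

variable {N : ℕ} {A : Matrix (Fin N) (Fin N) ℕ}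
  {H K : Type*} [NormedAddCommGroup H] [InnerProductSpace ℂ H] [CompleteSpace H]
  [NormedAddCommGroup K] [InnerProductSpace ℂ K] [CompleteSpace K]

/-- A sequence of vectors along which the generators prescribed by the sequence `x` act as
backward shifts, and their adjoints as forward shifts. -/
structure IsOrbit (π : CuntzKriegerAlgebra.{u} A →⋆ₐ[ℂ] (H →L[ℂ] H)) (x : ℕ → Fin N)
    (v : ℕ → H) : Prop where
  gen_apply : ∀ n, π (gen A (x n)) (v (n + 1)) = v n
  star_apply : ∀ n, π (star (gen A (x n))) (v n) = v (n + 1)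

namespace IsOrbit

variable {π : CuntzKriegerAlgebra.{u} A →⋆ₐ[ℂ] (H →L[ℂ] H)}
  {ρ : CuntzKriegerAlgebra.{u} A →⋆ₐ[ℂ] (K →L[ℂ] K)} {x : ℕ → Fin N} {v : ℕ → H} {w : ℕ → K}

theorem shift (h : IsOrbit π x v) (m : ℕ) :
    IsOrbit π (fun i => x (m + i)) fun i => v (m + i) where
  gen_apply n := h.gen_apply (m + n)
  star_apply n := h.star_apply (m + n)

/-- The vector `v (n+1)` lies in the range of `s_{x (n+1)}`, and there `s_{x n}* s_{x n}` acts as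
the scalar `A (x n) (x (n+1)) = 1`. -/
theorem of_gen_apply (hx : ∀ n, A (x n) (x (n + 1)) = 1)
    (h : ∀ n, π (gen A (x n)) (v (n + 1)) = v n) : IsOrbit π x v where
  gen_apply := h
  star_apply n := by
    rw [← h n, ← h (n + 1), ← map_mul_vec, ← map_mul_vec, star_gen_mul_gen_mul_gen, hx, one_smul]

theorem star_word_apply (h : IsOrbit π x v) (m : ℕ) :
    π (star (word A (initialWord x m))) (v 0) = v m := by
  induction m with
  | zero => rw [initialWord_zero, word_nil, star_one, map_one, one_apply_eq_self]
  | succ m ih =>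
    rw [initialWord_succ, word_append, star_mul, map_mul_vec, ih, ← h.star_apply]
    simp [word]

theorem word_apply (h : IsOrbit π x v) (m : ℕ) :
    π (word A (initialWord x m)) (v m) = v 0 := by
  induction m with
  | zero => rw [initialWord_zero, word_nil, map_one, one_apply_eq_self]
  | succ m ih =>
    rw [initialWord_succ, word_append, map_mul_vec, ← ih, ← h.gen_apply m]
    simp [word]

/-- Matching letters shift the orbit. The first wrong letter `i` meets a vector in the range of a
different generator, which `s_i*` kills. -/
theorem star_word_apply_of_ne (h : IsOrbit π x v) {J : List (Fin N)}
    (hJ : J ≠ initialWord x J.length) : π (star (word A J)) (v 0) = 0 := by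
  induction J generalizing x v with
  | nil => exact absurd rfl hJ
  | cons i J ih =>
    rw [word_cons, star_mul, map_mul_vec]
    by_cases hi : i = x 0
    · subst hi
      rw [h.star_apply]
      refine ih (h.shift 1) fun hJ' => hJ ?_
      rw [List.length_cons, initialWord_succ', ← hJ']
    · rw [← h.gen_apply 0, ← map_mul_vec π (star (gen A i)), star_gen_mul_gen_of_ne hi, map_zero,
        zero_apply, map_zero]

open Classical in
theorem inner_word_mul_star (h : IsOrbit π x v) (J' J'' : List (Fin N)) :
    inner ℂ (v 0) (π (word A J' * star (word A J'')) (v 0)) =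
      if J' = initialWord x J'.length ∧ J'' = initialWord x J''.length
      then inner ℂ (v J'.length) (v J''.length) else 0 := by
  rw [map_mul_vec, ← inner_map_star_left]
  split_ifs with hc
  · nth_rewrite 1 [hc.1]
    nth_rewrite 1 [hc.2]
    rw [h.star_word_apply, h.star_word_apply]
  · rw [not_and_or] at hc
    rcases hc with hc | hc
    · rw [h.star_word_apply_of_ne hc, inner_zero_left]
    · rw [h.star_word_apply_of_ne hc, inner_zero_right]

/-- The state of the first vector of an orbit depends only on the sequence and on the Gram
matrix. -/
theorem inner_eq_inner (h : IsOrbit π x v) (h' : IsOrbit ρ x w)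
    (hg : ∀ m n, inner ℂ (v m) (v n) = inner ℂ (w m) (w n)) (a : CuntzKriegerAlgebra.{u} A) :
    inner ℂ (v 0) (π a (v 0)) = inner ℂ (w 0) (ρ a (w 0)) := by
  refine positive_ext (φ := vectorState π (v 0)) (ψ := vectorState ρ (w 0)) (fun J' J'' => ?_) a
  rw [vectorState_apply, vectorState_apply, h.inner_word_mul_star, h'.inner_word_mul_star, hg]

theorem inner_succ (h : IsOrbit π x v) {m n : ℕ} (hmn : x m = x n) :
    inner ℂ (v m) (v n) = inner ℂ (v (m + 1)) (v (n + 1)) := by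
  rw [← h.gen_apply m, ← inner_map_star, hmn, h.star_apply]

theorem inner_self (h : IsOrbit π x v) (m : ℕ) : inner ℂ (v m) (v m) = inner ℂ (v 0) (v 0) := by
  induction m with
  | zero => rfl
  | succ m ih => rw [← h.inner_succ rfl, ih]

/-- A segment of the tail from `m` that reaches the first known disagreement writes `v m` as `s_K v
(m+i+1)`, while `s_K*` annihilates `v n`. -/
theorem inner_eq_zero (h : IsOrbit π x v) {m n : ℕ} (hmn : ¬ ∀ i, x (m + i) = x (n + i)) :
    inner ℂ (v m) (v n) = 0 := by
  obtain ⟨i, hi⟩ := not_forall.mp hmn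
  have h1 := (h.shift m).word_apply (i + 1)
  have h2 := (h.shift n).star_word_apply_of_ne (J := initialWord (fun i => x (m + i)) (i + 1))
    fun he => hi (eq_of_initialWord_eq (by simpa using he) (Nat.lt_succ_self i))
  simp only [add_zero] at h1 h2
  rw [← h1, ← inner_map_star, h2, inner_zero_right]

end IsOrbit

variable {π : CuntzKriegerAlgebra.{u} A →⋆ₐ[ℂ] (H →L[ℂ] H)}

/-- The orbit of a vector fixed by a cyclic word. -/
theorem IsCyclicWord.isOrbit {J : List (Fin N)} (hJ : IsCyclicWord A J) {ξ : H}
    (hξ : π (word A J) ξ = ξ) :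
    IsOrbit π (cyclicSeq J hJ.1) fun n => π (word A (J.drop (n % J.length))) ξ := by
  obtain ⟨hne, hch, hlast⟩ := hJ
  have hpos : 0 < J.length := List.length_pos_iff.mpr hne
  refine .of_gen_apply (fun n => ?_) fun n => ?_
  · have hlt := Nat.mod_lt n hpos
    rcases Nat.lt_or_ge (n % J.length + 1) J.length with h | h
    · have h1 : (n + 1) % J.length = n % J.length + 1 := by
        rw [← Nat.mod_add_mod, Nat.mod_eq_of_lt h]
      simp only [cyclicSeq, h1]
      exact List.isChain_iff_getElem.mp hch _ h
    · have h0 : n % J.length = J.length - 1 := by omega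
      have h1 : (n + 1) % J.length = 0 := by
        rw [← Nat.mod_add_mod, h0, Nat.sub_add_cancel hpos, Nat.mod_self]
      simp only [cyclicSeq, h1, h0]
      rw [← List.getLast_eq_getElem hne, ← List.head_eq_getElem_zero hne]
      exact hlast _ (by simp [List.getLast?_eq_some_getLast hne]) _
        (by simp [List.head?_eq_some_head hne])
  · have hlt := Nat.mod_lt n hpos
    have hdrop : J.drop (n % J.length) = cyclicSeq J hne n :: J.drop (n % J.length + 1) :=
      List.drop_eq_getElem_cons hlt
    rw [hdrop, word_cons, map_mul_vec]
    rcases Nat.lt_or_ge (n % J.length + 1) J.length with h | h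
    · rw [← Nat.mod_add_mod n, Nat.mod_eq_of_lt h]
    -- After the last letter the orbit restarts at `s_J ξ`, while the remaining suffix is empty. The
    -- two agree because `s_J ξ = ξ`.
    · have h0 : n % J.length + 1 = J.length := by omega
      rw [← Nat.mod_add_mod n, h0, Nat.mod_self, List.drop_zero, hξ, List.drop_length, word_nil,
        map_one, one_apply_eq_self]

/-- The orbit of a unit vector `ξ` whose images under all `s_{j_n}* ⋯ s_{j_1}*` are unit
vectors. -/
theorem isOrbit_of_norm_eq_one {x : ℕ → Fin N} {ξ : H}
    (hξ : ∀ n, ‖π (star (word A (initialWord x n))) ξ‖ = 1) :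
    IsOrbit π x fun n => π (star (word A (initialWord x n))) ξ := by
  have hs : ∀ n, π (star (gen A (x n))) (π (star (word A (initialWord x n))) ξ) =
      π (star (word A (initialWord x (n + 1)))) ξ := fun n => by
    rw [initialWord_succ, word_append, star_mul, map_mul_vec]
    simp [word]
  refine ⟨fun n => ?_, hs⟩
  -- Moving `s_{x n}` across the inner product gives `⟨v n, s_{x n} v (n+1)⟩ = ‖v (n+1)‖² = 1`.
  -- Since `s_{x n}` is a contraction, this forces equality.
  refine eq_of_inner_eq_one (hξ n) ?_ ?_
  · rw [← hξ (n + 1)]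
    exact norm_map_apply_le π (norm_gen_le _) _
  · rw [← inner_map_star_left, hs, inner_self_eq_norm_sq_to_K, hξ]
    simp

end Orbits

/-! ### The representations `P(J)`: values of the state, uniqueness and purity. -/

section GPRepresentations

open CuntzKriegerAlgebra

variable {N : ℕ} {A : Matrix (Fin N) (Fin N) ℕ}
  {H K : Type*} [NormedAddCommGroup H] [InnerProductSpace ℂ H] [CompleteSpace H]
  [NormedAddCommGroup K] [InnerProductSpace ℂ K] [CompleteSpace K]
  {π : CuntzKriegerAlgebra.{u} A →⋆ₐ[ℂ] (H →L[ℂ] H)}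
  {ρ : CuntzKriegerAlgebra.{u} A →⋆ₐ[ℂ] (K →L[ℂ] K)} {Ω : H}

theorem IsCycleRep.map_unitary {J : List (Fin N)} (h : IsCycleRep π J Ω) (U : H ≃ₗᵢ[ℂ] K)
    (hU : ∀ a v, U (π a v) = ρ a (U v)) : IsCycleRep ρ J (U Ω) where
  norm_eq_one := by rw [U.norm_map, h.norm_eq_one]
  cyclic := h.cyclic.map_unitary U hU
  fixed := by rw [← hU, h.fixed]
  orthonormal := by
    simp_rw [← hU]
    exact h.orthonormal.comp_linearIsometryEquiv U

theorem IsChainRep.map_unitary {J : ℕ → Fin N} (h : IsChainRep π J Ω) (U : H ≃ₗᵢ[ℂ] K)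
    (hU : ∀ a v, U (π a v) = ρ a (U v)) : IsChainRep ρ J (U Ω) where
  norm_eq_one := by rw [U.norm_map, h.norm_eq_one]
  cyclic := h.cyclic.map_unitary U hU
  orthonormal := by
    simp_rw [← hU]
    exact h.orthonormal.comp_linearIsometryEquiv U

/-- The GNS representation of the state of a cyclic vector. -/
theorem exists_gns_unitary {φ : CuntzKriegerAlgebra.{u} A →ₚ[ℂ] ℂ} (hΩ : IsCyclicVector π Ω)
    (h : ∀ J K, φ (word A J * star (word A K)) = vectorState π Ω (word A J * star (word A K))) :
    ∃ U : φ.GNS ≃ₗᵢ[ℂ] H, ∀ a v, U (φ.gnsStarAlgHom a v) = π a (U v) := by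
  obtain ⟨U, hU, -⟩ := exists_unitary_of_inner_eq (isCyclicVector_gnsVector φ) hΩ
    fun a => (inner_gnsVector φ a).trans (positive_ext h a)
  exact ⟨U, hU⟩

theorem intertwine_symm {U : K ≃ₗᵢ[ℂ] H} (hU : ∀ a v, U (ρ a v) = π a (U v))
    (a : CuntzKriegerAlgebra.{u} A) (v : H) : U.symm (π a v) = ρ a (U.symm v) := by
  rw [LinearIsometryEquiv.symm_apply_eq, hU, U.apply_symm_apply]

section Cycle

variable {J : List (Fin N)}

theorem IsCycleRep.isOrbit (h : IsCycleRep π J Ω) (hJ : IsCyclicWord A J) :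
    IsOrbit π (cyclicSeq J hJ.1) fun n => π (word A (J.drop (n % J.length))) Ω :=
  hJ.isOrbit h.fixed

theorem IsCycleRep.inner_eq (h : IsCycleRep π J Ω) (hJ : J ≠ []) (m n : ℕ) :
    inner ℂ (π (word A (J.drop (m % J.length))) Ω) (π (word A (J.drop (n % J.length))) Ω) =
      if m % J.length = n % J.length then (1 : ℂ) else 0 := by
  have hpos : 0 < J.length := List.length_pos_iff.mpr hJ
  simpa using orthonormal_iff_ite.mp h.orthonormal
    ⟨m % J.length, Nat.mod_lt _ hpos⟩ ⟨n % J.length, Nat.mod_lt _ hpos⟩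

theorem IsCycleRep.orbit_zero (h : IsCycleRep π J Ω) :
    π (word A (J.drop (0 % J.length))) Ω = Ω := by
  rw [Nat.zero_mod, List.drop_zero, h.fixed]

theorem IsCycleRep.vectorState_eq (h : IsCycleRep π J Ω) (hJ : IsCyclicWord A J)
    (J' J'' : List (Fin N)) :
    vectorState π Ω (word A J' * star (word A J'')) = cycleValue J J' J'' := by
  have h1 := (h.isOrbit hJ).inner_word_mul_star J' J''
  rw [h.orbit_zero, h.inner_eq hJ.1] at h1
  rw [vectorState_apply, h1, cycleValue_eq J hJ.1]

/-- The single contraction `s_J` determines the state: value `1` there makes the GNS vector fixed by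
`s_J`. This yields an orbit along the same sequence, and nonperiodicity forces its Gram matrix. -/
theorem IsCycleRep.isPureState (h : IsCycleRep π J Ω) (hJ : IsCyclicWord A J)
    (hper : ¬ IsPeriodicWord J) : IsPureState (vectorState π Ω) := by
  refine isPureState_of_unique (isState_vectorState π h.norm_eq_one) fun ψ hψ hone a => ?_
  have hfix : ψ.gnsStarAlgHom (word A J) (gnsVector ψ) = gnsVector ψ := by
    refine hψ.gns_fixed (norm_word_le J) (hone _ (norm_word_le J) ?_)
    rw [vectorState_apply, h.fixed, inner_self_eq_norm_sq_to_K, h.norm_eq_one]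
    simp
  have ho := hJ.isOrbit hfix
  have h0 : ψ.gnsStarAlgHom (word A (J.drop (0 % J.length))) (gnsVector ψ) = gnsVector ψ := by
    rw [Nat.zero_mod, List.drop_zero, hfix]
  have hψ1 : inner ℂ (gnsVector ψ) (gnsVector ψ) = (1 : ℂ) := by
    rw [inner_self_eq_norm_sq_to_K, norm_gnsVector hψ]
    simp
  have hinn := ho.inner_eq_inner (h.isOrbit hJ) (fun m n => by
    rw [h.inner_eq hJ.1]
    split_ifs with hmn
    · rw [hmn, ho.inner_self n, h0, hψ1]
    · exact ho.inner_eq_zero fun hs => hmn (mod_eq_of_cyclicSeq_shift_eq hJ.1 hper hs)) a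
  rwa [h0, h.orbit_zero, inner_gnsVector] at hinn

theorem IsCycleRep.not_isPureState (h : IsCycleRep π J Ω) (hJ : IsCyclicWord A J)
    (hper : IsPeriodicWord J) : ¬ IsPureState (vectorState π Ω) := by
  obtain ⟨m, hm, J₀, hJ₀, hJm⟩ := hper
  have hx : cyclicSeq J hJ.1 = cyclicSeq J₀ hJ₀ := by
    subst hJm
    exact cyclicSeq_wordPow J₀ hJ₀ m _
  have hpos : 0 < J₀.length := List.length_pos_iff.mpr hJ₀
  have hlt : J₀.length < J.length := by
    rw [hJm, length_wordPow]
    nlinarith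
  have ho := h.isOrbit hJ
  have hw := ho.star_word_apply J₀.length
  rw [hx, initialWord_cyclicSeq_length, h.orbit_zero] at hw
  have ho' := ho.shift J₀.length
  rw [hx, show (fun i => cyclicSeq J₀ hJ₀ (J₀.length + i)) = cyclicSeq J₀ hJ₀ from
    funext (cyclicSeq_add J₀ hJ₀), ← hx] at ho'
  -- The translate is the orbit vector of index `|J₀| < |J|`. The sequence has period `|J₀|`, so the
  -- orbit from there follows the same word with the same Gram matrix.
  refine not_isPureState_vectorState h.norm_eq_one (star (word A J₀)) ?_ fun a => ?_
  · have h1 := h.inner_eq hJ.1 0 J₀.length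
    rw [h.orbit_zero, ← hw, Nat.zero_mod, Nat.mod_eq_of_lt hlt, if_neg hpos.ne] at h1
    exact h1
  · have h1 := ho'.inner_eq_inner ho (fun m n => by
      rw [h.inner_eq hJ.1, h.inner_eq hJ.1]
      refine if_congr ⟨fun hmn => ?_, fun hmn => ?_⟩ rfl rfl
      · exact Nat.ModEq.add_left_cancel' _ hmn
      · exact Nat.ModEq.add_left _ hmn) a
    rwa [h.orbit_zero, add_zero, ← hw] at h1

end Cycle

section Chain

variable {x : ℕ → Fin N}

theorem IsChainRep.isOrbit (h : IsChainRep π x Ω) :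
    IsOrbit π x fun n => π (star (word A (initialWord x n))) Ω := by
  refine isOrbit_of_norm_eq_one fun n => ?_
  match n with
  | 0 => rw [initialWord_zero, word_nil, star_one, map_one, one_apply_eq_self, h.norm_eq_one]
  | n + 1 => exact h.orthonormal.1 n

theorem chain_orbit_zero (π : CuntzKriegerAlgebra.{u} A →⋆ₐ[ℂ] (H →L[ℂ] H)) (x : ℕ → Fin N)
    (Ω : H) : π (star (word A (initialWord x 0))) Ω = Ω := by
  rw [initialWord_zero, word_nil, star_one, map_one, one_apply_eq_self]

/-- Orthonormality is assumed only from index `1` on. To include `Ω` itself, equal letters allow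
both indices to be raised by one, and different letters already give orthogonality. -/
theorem IsChainRep.inner_eq (h : IsChainRep π x Ω) (m n : ℕ) :
    inner ℂ (π (star (word A (initialWord x m))) Ω) (π (star (word A (initialWord x n))) Ω) =
      if m = n then (1 : ℂ) else 0 := by
  have hs : ∀ m n, inner ℂ (π (star (word A (initialWord x (m + 1)))) Ω)
      (π (star (word A (initialWord x (n + 1)))) Ω) = if m = n then (1 : ℂ) else 0 := fun m n =>
    orthonormal_iff_ite.mp h.orthonormal m n
  have ho := h.isOrbit
  by_cases hx : x m = x n
  · have h1 := ho.inner_succ hx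
    rw [h1, hs]
  · rw [if_neg fun hmn => hx (by rw [hmn])]
    exact ho.inner_eq_zero fun hi => hx (hi 0)

theorem IsChainRep.vectorState_eq (h : IsChainRep π x Ω) (J' J'' : List (Fin N)) :
    vectorState π Ω (word A J' * star (word A J'')) = chainValue x J' J'' := by
  have h1 := h.isOrbit.inner_word_mul_star J' J''
  rw [chain_orbit_zero, h.inner_eq] at h1
  rw [vectorState_apply, h1, chainValue_eq]

/-- Here the determining contractions are `s_K s_K*` for the initial segments `K` of `x`. Value `1`
at all of them makes every `s_K*` preserve the norm of the GNS vector. -/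
theorem IsChainRep.isPureState (h : IsChainRep π x Ω) (hper : ¬ IsEventuallyPeriodic x) :
    IsPureState (vectorState π Ω) := by
  refine isPureState_of_unique (isState_vectorState π h.norm_eq_one) fun ψ hψ hone a => ?_
  have hinn : ∀ n, inner ℂ (ψ.gnsStarAlgHom (star (word A (initialWord x n))) (gnsVector ψ))
      (ψ.gnsStarAlgHom (star (word A (initialWord x n))) (gnsVector ψ)) = (1 : ℂ) := fun n => by
    rw [inner_map_star_left, ← map_mul_vec, inner_gnsVector]
    refine hone _ ?_ ?_
    · refine (norm_mul_le _ _).trans (mul_le_one₀ (norm_word_le _) (norm_nonneg _) ?_)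
      rw [norm_star]
      exact norm_word_le _
    · rw [vectorState_apply, map_mul_vec, ← inner_map_star_left, h.inner_eq, if_pos rfl]
  have ho := isOrbit_of_norm_eq_one (π := ψ.gnsStarAlgHom) (x := x) (ξ := gnsVector ψ)
    fun n => norm_eq_one_of_inner_self (hinn n)
  have h2 := ho.inner_eq_inner h.isOrbit (fun m n => by
    rw [h.inner_eq]
    split_ifs with hmn
    · rw [hmn, hinn]
    · exact ho.inner_eq_zero fun hs => hmn (eq_of_shift_eq hper hs)) a
  rwa [chain_orbit_zero, chain_orbit_zero, inner_gnsVector] at h2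

theorem IsChainRep.not_isPureState (h : IsChainRep π x Ω) (hper : IsEventuallyPeriodic x) :
    ¬ IsPureState (vectorState π Ω) := by
  obtain ⟨k, d, hd, hx⟩ := isEventuallyPeriodic_iff.mp hper
  have ho := h.isOrbit
  have hword := ho.word_apply k
  rw [chain_orbit_zero] at hword
  have ho' := ho.shift (k + d)
  rw [funext hx] at ho'
  have hinn := ho'.inner_eq_inner (ho.shift k) fun m n => by
    rw [h.inner_eq, h.inner_eq]
    simp only [Nat.add_left_cancel_iff]
  simp only [add_zero] at hinn
  -- The orbit vectors of indices `k` and `k + d` are orthogonal and induce the same state, since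
  -- their tails agree. The word of length `k` carries the first back to `Ω`, and the second to the
  -- required translate.
  refine not_isPureState_vectorState h.norm_eq_one
    (word A (initialWord x k) * star (word A (initialWord x (k + d)))) ?_ fun a => ?_
  · rw [map_mul_vec, ← inner_map_star_left, h.inner_eq, if_neg (by omega)]
  · have h1 := hinn (star (word A (initialWord x k)) * a * word A (initialWord x k))
    rw [map_mul_vec, map_mul_vec, map_mul_vec, map_mul_vec, inner_map_star, inner_map_star,
      hword] at h1
    rw [map_mul_vec, h1]

end Chain

end GPRepresentations

theorem proposition6p1 {N : ℕ} (hN : 2 ≤ N) (A : Matrix (Fin N) (Fin N) ℕ)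
    (hA : IsZeroOneMatrix A) {H : Type v} [NormedAddCommGroup H] [InnerProductSpace ℂ H]
    [CompleteSpace H] (π : CuntzKriegerAlgebra.{u} A →⋆ₐ[ℂ] (H →L[ℂ] H)) (Ω : H) :
    (∀ J : List (Fin N), IsCyclicWord A J → IsCycleRep π J Ω →
      (∀ J' J'' : List (Fin N),
        vectorState π Ω (CuntzKriegerAlgebra.word A J' * star (CuntzKriegerAlgebra.word A J''))
          = cycleValue J J' J'') ∧
      (∀ φ : CuntzKriegerAlgebra.{u} A →ₚ[ℂ] ℂ, IsState φ →
        (∀ J' J'' : List (Fin N),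
          φ (CuntzKriegerAlgebra.word A J' * star (CuntzKriegerAlgebra.word A J''))
            = cycleValue J J' J'') →
        (∃ ξ, IsCycleRep (H := φ.GNS) φ.gnsStarAlgHom J ξ) ∧ UnitarilyEquivalent (H := φ.GNS) φ.gnsStarAlgHom π) ∧
      (IsPureState (vectorState π Ω) ↔ ¬ IsPeriodicWord J)) ∧
    (∀ J : ℕ → Fin N, IsInfiniteWord A J → IsChainRep π J Ω →
      (∀ J' J'' : List (Fin N),
        vectorState π Ω (CuntzKriegerAlgebra.word A J' * star (CuntzKriegerAlgebra.word A J''))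
          = chainValue J J' J'') ∧
      (∀ φ : CuntzKriegerAlgebra.{u} A →ₚ[ℂ] ℂ, IsState φ →
        (∀ J' J'' : List (Fin N),
          φ (CuntzKriegerAlgebra.word A J' * star (CuntzKriegerAlgebra.word A J''))
            = chainValue J J' J'') →
        (∃ ξ, IsChainRep (H := φ.GNS) φ.gnsStarAlgHom J ξ) ∧ UnitarilyEquivalent (H := φ.GNS) φ.gnsStarAlgHom π) ∧
      (IsPureState (vectorState π Ω) ↔ ¬ IsEventuallyPeriodic J)) := by
  refine ⟨fun J hJ h => ⟨h.vectorState_eq hJ, fun φ _ hφ => ?_,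
      fun hp hper => h.not_isPureState hJ hper hp, h.isPureState hJ⟩,
    fun J _ h => ⟨h.vectorState_eq, fun φ _ hφ => ?_,
      fun hp hper => h.not_isPureState hper hp, h.isPureState⟩⟩
  · obtain ⟨U, hU⟩ := exists_gns_unitary (φ := φ) h.cyclic fun J' J'' =>
      (hφ J' J'').trans (h.vectorState_eq hJ J' J'').symm
    exact ⟨⟨U.symm Ω, h.map_unitary U.symm (intertwine_symm hU)⟩, U, hU⟩
  · obtain ⟨U, hU⟩ := exists_gns_unitary (φ := φ) h.cyclic fun J' J'' =>
      (hφ J' J'').trans (h.vectorState_eq J' J'').symm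
    exact ⟨⟨U.symm Ω, h.map_unitary U.symm (intertwine_symm hU)⟩, U, hU⟩
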